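/- Fix a norm $|\cdot|$ on $\mathbb R^d$ and let $\operatorname{Haus}$ be the induced Hausdorff metric on the family $K(\mathbb R^d)$ of nonempty compact subsets of $\mathbb R^d$. For $A,B\in K(\mathbb R^d)$, a pair $(a,b)\in A\times B$ is a *metric pair* of $(A,B)$ if $|a-b|=\operatorname{dist}(b,A)$ or $|a-b|=\operatorname{dist}(a,B)$; a *metric chain* of $A_0,\dots,A_m$ is a tuple $(y_0,\dots,y_m)$ with $y_i\in A_i$ such that every $(y_i,y_{i+1})$ is a metric pair of $(A_i,A_{i+1})$. For $F:[0,1]\to K(\mathbb R^d)$, $\kappa:[0,1]\to\mathbb R$ and a partition $\chi=\{0=x_0<\dots<x_m=1\}$ put $$S_{\chi,\kappa}F=\Big\{\sum_{i=0}^{m-1}(x_{i+1}-x_i)\,\kappa(x_i)\,y_i:\ (y_0,\dots,y_{m-1})\text{ is a metric chain of }F(x_0),\dots,F(x_{m-1})\Big\}.$$ The *weighted metric integral* of $F$ with weight $\kappa$ is the upper Kuratowski limit of $S_{\chi,\kappa}F$ as $|\chi|=\max_i(x_{i+1}-x_i)\to0$, i.e. the set of all $\lim_{k\to\infty} z_k$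 with $z_k\in S_{\chi_k,\kappa}F$ and $|\chi_k|\to0$. Let $p_{n,k}(x)=\binom nk x^k(1-x)^{n-k}$. For $n\in\mathbb N$, $n\ge1$, and $x\in[0,1]$ let $M_nF(x)$ (Bernstein–Durrmeyer) and $K_nF(x)$ (Kantorovich) be the weighted metric integrals of $F$ with weights $$t\mapsto(n+1)\sum_{k=0}^n p_{n,k}(x)p_{n,k}(t)\qquad\text{and}\qquad t\mapsto(n+1)\sum_{k=0}^n p_{n,k}(x)\,\mathbf 1_{[\frac k{n+1},\frac{k+1}{n+1}]}(t),$$ respectively. Let $\mathcal F[0,1]$ be the class of $F:[0,1]\to K(\mathbb R^d)$ of bounded variation (with respect to $\operatorname{Haus}$) with compact graph. For such $F$ let $v_F(x)=V_0^x(F)$ be its variation function, $\|F\|_\infty=\sup_{x\in[0,1]}\operatorname{Haus}(F(x),\{0\})$, and let $$\omega(v_F,x,\delta)=\sup\{|v_F(x_1)-v_F(x_2)|:\ x_1,x_2\in[x-\tfrac\delta2,x+\tfrac\delta2]\cap[0,1]\}.$$ **Statement.** Let $F\in\mathcal F[0,1]$. Then, for all $n\ge1$ and $x\in[0,1]$,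 the sets $M_nF(x)$ and $K_nF(x)$ are nonempty and compact, and the following hold. (A) Bernstein–Durrmeyer operators. (i) For all $x\in[0,1]$, $\delta>0$ and $n\ge1$: $\ \operatorname{Haus}(M_nF(x),F(x))\le\omega(v_F,x,4\delta)+\|F\|_\infty\dfrac1{n\delta^2}$. (ii) If $x\in[0,1]$ is a point of continuity of $F$, then $\lim_{n\to\infty}\operatorname{Haus}(M_nF(x),F(x))=0$. (iii) If $F$ is continuous at all points of a closed interval $I\subseteq[0,1]$, then $\operatorname{Haus}(M_nF(x),F(x))\to0$ uniformly in $x\in I$. (B) Kantorovich operators. Statements (ii) and (iii) hold with $K_n$ in place of $M_n$, and for all $x\in[0,1]$, $\delta>0$ and $n\ge1$: $\ \operatorname{Haus}(K_nF(x),F(x))\le\omega(v_F,x,4\delta)+\|F\|_\infty\dfrac1{2n\delta^2}$. -/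

import Mathlib

open Set Filter Topology TopologicalSpace

noncomputable section

namespace MetricApprox

/-- A partition `a = x₀ < x₁ < ⋯ < x_m = b` of `[a, b]`. -/
structure IntervalPartition (a b : ℝ) where
  m : ℕ
  pt : Fin (m + 1) → ℝ
  strictMono_pt : StrictMono pt
  pt_zero : pt 0 = a
  pt_last : pt (Fin.last m) = b

/-- The norm `|χ| = max_i (x_{i+1} - x_i)` of a partition. -/
def IntervalPartition.mesh {a b : ℝ} (χ : IntervalPartition a b) : ℝ :=
  ⨆ i : Fin χ.m, (χ.pt i.succ - χ.pt i.castSucc)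

variable {E : Type*} [NormedAddCommGroup E]

/-- The metric pairs of two sets: pairs `(a, b) ∈ A × B` such that `a` is a projection of `b`
on `A` or `b` is a projection of `a` on `B`. -/
def metricPairs (A B : Set E) : Set (E × E) :=
  {p | p.1 ∈ A ∧ p.2 ∈ B ∧
    (dist p.2 p.1 = Metric.infDist p.2 A ∨ dist p.1 p.2 = Metric.infDist p.1 B)}

/-- The metric chains of a finite sequence of sets: tuples of points of these sets in which any
two consecutive entries form a metric pair. -/
def metricChains {m : ℕ} (A : Fin m → Set E) : Set (Fin m → E) :=
  {y | (∀ i, y i ∈ A i) ∧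
    ∀ i j : Fin m, (i : ℕ) + 1 = (j : ℕ) → (y i, y j) ∈ metricPairs (A i) (A j)}

/-- The weighted metric Riemann sum of `F` for the partition `χ`: the set of all
`∑_{i<m} (x_{i+1} - x_i) κ(x_i) y_i`, where `(y_0, …, y_{m-1})` is a metric chain of
`F(x_0), …, F(x_{m-1})`. -/
def metricRiemannSum [NormedSpace ℝ E] {a b : ℝ} (κ : ℝ → ℝ) (F : ℝ → NonemptyCompacts E)
    (χ : IntervalPartition a b) : Set E :=
  {z | ∃ y ∈ metricChains (fun i : Fin χ.m => (F (χ.pt i.castSucc) : Set E)),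
    z = ∑ i : Fin χ.m, ((χ.pt i.succ - χ.pt i.castSucc) * κ (χ.pt i.castSucc)) • y i}

/-- The weighted metric integral: the upper Kuratowski limit of the weighted metric Riemann sums
as the norm of the partition tends to zero. -/
def weightedMetricIntegral [NormedSpace ℝ E] (a b : ℝ) (κ : ℝ → ℝ)
    (F : ℝ → NonemptyCompacts E) : Set E :=
  {z | ∃ (χ : ℕ → IntervalPartition a b) (y : ℕ → E),
    Tendsto (fun k => (χ k).mesh) atTop (𝓝 0) ∧
    (∀ k, y k ∈ metricRiemannSum κ F (χ k)) ∧ Tendsto y atTop (𝓝 z)}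

/-- The class of set-valued functions of bounded variation (with respect to the Hausdorff metric,
which is the metric of `NonemptyCompacts E`) on `[a, b]` with compact graph over `[a, b]`. -/
structure IsBVCompactGraph (a b : ℝ) (F : ℝ → NonemptyCompacts E) : Prop where
  boundedVariation : BoundedVariationOn F (Icc a b)
  isCompact_graph : IsCompact {p : ℝ × E | p.1 ∈ Icc a b ∧ p.2 ∈ F p.1}

/-- `‖F‖_∞ = sup_{x ∈ [a, b]} |F(x)|`, where `|A| = haus(A, {0})`. -/
def supNorm (a b : ℝ) (F : ℝ → NonemptyCompacts E) : ℝ :=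
  ⨆ x : Icc a b, Metric.hausdorffDist (F x : Set E) {0}

/-- The variation function `v_f(x) = V_a^x(f)`. -/
def variationFun {X : Type*} [PseudoEMetricSpace X] (a : ℝ) (f : ℝ → X) (x : ℝ) : ℝ :=
  (eVariationOn f (Icc a x)).toReal

/-- The local modulus of continuity at `x` of a function on `[a, b]`: the supremum of
`ρ(f(x₁), f(x₂))` over `x₁, x₂ ∈ [x - δ/2, x + δ/2] ∩ [a, b]`. -/
def localModulus {X : Type*} [PseudoMetricSpace X] (a b : ℝ) (f : ℝ → X) (x δ : ℝ) : ℝ :=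
  sSup {r | ∃ x₁ ∈ Icc (x - δ / 2) (x + δ / 2) ∩ Icc a b,
    ∃ x₂ ∈ Icc (x - δ / 2) (x + δ / 2) ∩ Icc a b, r = dist (f x₁) (f x₂)}

/-- The Bernstein–Durrmeyer kernel `(n+1) ∑_{k=0}^n p_{n,k}(x) p_{n,k}(t)`. -/
def durrmeyerKernel (n : ℕ) (x t : ℝ) : ℝ :=
  ((n : ℝ) + 1) * ∑ k ∈ Finset.range (n + 1),
    (bernsteinPolynomial ℝ n k).eval x * (bernsteinPolynomial ℝ n k).eval t

/-- The Kantorovich kernel `(n+1) ∑_{k=0}^n p_{n,k}(x) χ_{[k/(n+1), (k+1)/(n+1)]}(t)`. -/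
def kantorovichKernel (n : ℕ) (x t : ℝ) : ℝ :=
  ((n : ℝ) + 1) * ∑ k ∈ Finset.range (n + 1),
    (bernsteinPolynomial ℝ n k).eval x *
      (Icc ((k : ℝ) / ((n : ℝ) + 1)) (((k : ℝ) + 1) / ((n : ℝ) + 1))).indicator
        (fun _ => (1 : ℝ)) t

/-- The Bernstein–Durrmeyer operator on set-valued functions on `[0, 1]`. -/
def durrmeyerOp [NormedSpace ℝ E] (n : ℕ) (F : ℝ → NonemptyCompacts E) (x : ℝ) : Set E :=
  weightedMetricIntegral 0 1 (durrmeyerKernel n x) F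

/-- The Kantorovich operator on set-valued functions on `[0, 1]`. -/
def kantorovichOp [NormedSpace ℝ E] (n : ℕ) (F : ℝ → NonemptyCompacts E) (x : ℝ) : Set E :=
  weightedMetricIntegral 0 1 (kantorovichKernel n x) F

end MetricApprox

end

/-! Both kernels κ are nonnegative, have integral 1, and concentrate at `x`: their second moment C
about `x` is at most 1/(2n) (Durrmeyer) or 1/(4n) (Kantorovich). Consecutive entries of a metric
chain are no farther apart than the Hausdorff distance of their sets, so any two entries differ by
at most the increment of v_F between their nodes (`dist_le_of_mem_metricChains`). A weighted Riemann
sum along a chain is therefore nearly an average of points which, at nodes within δ of `x`, stay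
within ω(v_F, x, 4δ) of a reference point, and elsewhere are at most 2‖F‖ from it. By Chebyshev the
far nodes carry mass at most C/δ², so the error is at most ω + 2‖F‖C/δ² in the limit
(`norm_riemannSum_sub_le`).

The two halves of the Hausdorff distance differ in the reference point. From the integral to F(x),
it is a limit of chain entries at nodes approaching `x`, which lies in F(x) because the graph is
compact (`exists_mem_value_dist_le`). From F(x) to the integral, it is the given point of F(x):
partitions containing `x` carry chains through it, and their sums have a convergent subsequence
(`exists_mem_weightedMetricIntegral_dist_le`).

The sums of κ and κ(t-x)² converge because these functions have bounded variation. Convergence of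
the operators follows since v_F is continuous wherever F is, which makes its local modulus small,
uniformly on compact sets of continuity points. -/

namespace MetricApprox

/-! ### Partitions and left Riemann sums -/

lemma sum_succ_sub_castSucc {m : ℕ} (w : Fin (m + 1) → ℝ) :
    ∑ i : Fin m, (w i.succ - w i.castSucc) = w (Fin.last m) - w 0 := by
  induction m with
  | zero => simp
  | succ m ih =>
    rw [Fin.sum_univ_castSucc]
    have := ih (fun i => w i.castSucc)
    simp only [← Fin.castSucc_succ, Fin.castSucc_zero] at this ⊢
    rw [this, Fin.succ_last]
    ring

namespace IntervalPartition

variable {a b : ℝ} (χ : IntervalPartition a b)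

lemma pt_mem (i : Fin (χ.m + 1)) : χ.pt i ∈ Icc a b :=
  ⟨χ.pt_zero.symm.trans_le (χ.strictMono_pt.monotone (Fin.zero_le i)),
    (χ.strictMono_pt.monotone (Fin.le_last i)).trans_eq χ.pt_last⟩

lemma step_nonneg (i : Fin χ.m) : 0 ≤ χ.pt i.succ - χ.pt i.castSucc :=
  sub_nonneg.2 (χ.strictMono_pt.monotone i.castSucc_lt_succ.le)

lemma step_le_mesh (i : Fin χ.m) : χ.pt i.succ - χ.pt i.castSucc ≤ χ.mesh :=
  le_ciSup (f := fun i : Fin χ.m => χ.pt i.succ - χ.pt i.castSucc) (finite_range _).bddAbove i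

lemma mesh_nonneg : 0 ≤ χ.mesh := Real.iSup_nonneg χ.step_nonneg

/-- The Riemann sum of `g` with the left end points as nodes. -/
def leftSum {a b : ℝ} (χ : IntervalPartition a b) (g : ℝ → ℝ) : ℝ :=
  ∑ i : Fin χ.m, (χ.pt i.succ - χ.pt i.castSucc) * g (χ.pt i.castSucc)

/-- Only left end points carry chain entries, so the nearby node must be one of them. If all were
farther than the mesh, no step could jump over `x`, and the last one could not reach `b`. -/
lemma exists_pt_castSucc_le {x : ℝ} (hab : a < b) (hx : x ∈ Icc a b) :
    ∃ i : Fin χ.m, |χ.pt i.castSucc - x| ≤ χ.mesh := by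
  by_contra! h
  have key : ∀ i : Fin (χ.m + 1), χ.pt i ≤ x := by
    intro i
    induction i using Fin.induction with
    | zero => rw [χ.pt_zero]; exact hx.1
    | succ i ih =>
      have h1 := h i
      have h2 := χ.step_le_mesh i
      rw [abs_of_nonpos (by linarith)] at h1
      linarith
  have hm : 0 < χ.m := by
    rcases Nat.eq_zero_or_pos χ.m with h0 | h0
    · exfalso
      have h3 : (0 : Fin (χ.m + 1)) = Fin.last χ.m := by
        ext; simp [h0]
      have h1 := χ.pt_zero
      rw [h3, χ.pt_last] at h1
      exact hab.ne' h1
    · exact h0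
  let j : Fin χ.m := ⟨χ.m - 1, by omega⟩
  have hj : j.succ = Fin.last χ.m := by ext; simp [j]; omega
  have h1 := h j
  have h2 := χ.step_le_mesh j
  rw [abs_of_nonpos (by linarith [key j.castSucc])] at h1
  rw [hj, χ.pt_last] at h2
  linarith [hx.2]

end IntervalPartition

/-- On each cell `g` deviates from its left value by at most the increment of its variation
function, and these increments telescope. Bounded variation, unlike continuity, also covers the
Kantorovich kernel. -/
lemma abs_leftSum_sub_integral_le {a b : ℝ} (hab : a ≤ b) {g : ℝ → ℝ}
    (hg : BoundedVariationOn g (Icc a b)) (χ : IntervalPartition a b) :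
    |χ.leftSum g - ∫ t in a..b, g t| ≤
      χ.mesh * variationOnFromTo g (Icc a b) a b := by
  have hl := hg.locallyBoundedVariationOn
  have hint : IntervalIntegrable g MeasureTheory.volume a b := by
    obtain ⟨p, q, hp, hq, rfl⟩ := hl.exists_monotoneOn_sub_monotoneOn
    rw [← uIcc_of_le hab] at hp hq
    exact hp.intervalIntegrable.sub hq.intervalIntegrable
  have ha : a ∈ Icc a b := left_mem_Icc.2 hab
  have hsub : ∀ {c d : ℝ}, c ∈ Icc a b → d ∈ Icc a b →
      IntervalIntegrable g MeasureTheory.volume c d := fun hc hd => by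
    rw [← uIcc_of_le hab] at hc hd
    exact hint.mono_set (uIcc_subset_uIcc hc hd)
  have h1 : ∫ t in a..b, g t = ∑ i : Fin χ.m, ∫ t in (χ.pt i.castSucc)..(χ.pt i.succ), g t := by
    have := sum_succ_sub_castSucc (fun i => ∫ t in a..(χ.pt i), g t)
    rw [χ.pt_last, χ.pt_zero, intervalIntegral.integral_same, sub_zero] at this
    rw [← this]
    refine Finset.sum_congr rfl fun i _ => ?_
    exact intervalIntegral.integral_interval_sub_left (hsub ha (χ.pt_mem _))
      (hsub ha (χ.pt_mem _))
  have h2 := sum_succ_sub_castSucc (fun i => variationOnFromTo g (Icc a b) a (χ.pt i))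
  rw [χ.pt_last, χ.pt_zero, variationOnFromTo.self, sub_zero] at h2
  rw [h1, ← h2, Finset.mul_sum, IntervalPartition.leftSum, ← Finset.sum_sub_distrib]
  refine (Finset.abs_sum_le_sum_abs _ _).trans (Finset.sum_le_sum fun i _ => ?_)
  have hle : χ.pt i.castSucc ≤ χ.pt i.succ := sub_nonneg.1 (χ.step_nonneg i)
  have h3 : (χ.pt i.succ - χ.pt i.castSucc) * g (χ.pt i.castSucc) -
      ∫ t in (χ.pt i.castSucc)..(χ.pt i.succ), g t =
      ∫ t in (χ.pt i.castSucc)..(χ.pt i.succ), (g (χ.pt i.castSucc) - g t) := by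
    rw [intervalIntegral.integral_sub (by simp) (hsub (χ.pt_mem _) (χ.pt_mem _))]
    simp
  have hmono := variationOnFromTo.monotoneOn hl ha
  rw [h3, ← Real.norm_eq_abs]
  refine (intervalIntegral.norm_integral_le_of_norm_le_const (C := variationOnFromTo g (Icc a b) a
    (χ.pt i.succ) - variationOnFromTo g (Icc a b) a (χ.pt i.castSucc)) ?_).trans ?_
  · intro t ht
    rw [uIoc_of_le hle] at ht
    have htm : t ∈ Icc a b :=
      ⟨(χ.pt_mem _).1.trans ht.1.le, ht.2.trans (χ.pt_mem _).2⟩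
    rw [norm_sub_rev, Real.norm_eq_abs]
    refine (variationOnFromTo.abs_sub_le_sub_of_le hl ha (χ.pt_mem _) htm ht.1.le).trans ?_
    gcongr
    exact hmono htm (χ.pt_mem _) ht.2
  · rw [abs_of_nonneg (χ.step_nonneg i), mul_comm]
    have := hmono (χ.pt_mem i.castSucc) (χ.pt_mem i.succ) hle
    exact mul_le_mul_of_nonneg_right (χ.step_le_mesh i) (sub_nonneg.2 this)

/-- The left Riemann sums of `g` converge to `c` along partitions with norm tending to zero. -/
def HasRiemannLimit (a b : ℝ) (g : ℝ → ℝ) (c : ℝ) : Prop :=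
  ∀ χ : ℕ → IntervalPartition a b, Tendsto (fun k => (χ k).mesh) atTop (𝓝 0) →
    Tendsto (fun k => (χ k).leftSum g) atTop (𝓝 c)

lemma hasRiemannLimit_integral {a b : ℝ} (hab : a ≤ b) {g : ℝ → ℝ}
    (hg : BoundedVariationOn g (Icc a b)) : HasRiemannLimit a b g (∫ t in a..b, g t) := by
  intro χ hχ
  rw [tendsto_iff_dist_tendsto_zero]
  refine squeeze_zero (fun _ => dist_nonneg)
    (fun k => abs_leftSum_sub_integral_le hab hg (χ k)) ?_
  simpa using hχ.mul_const _

lemma HasRiemannLimit.const_mul {a b : ℝ} {g : ℝ → ℝ} {c : ℝ} (h : HasRiemannLimit a b g c)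
    (r : ℝ) : HasRiemannLimit a b (fun t => r * g t) (r * c) := by
  intro χ hχ
  refine ((h χ hχ).const_mul r).congr fun k => ?_
  simp only [IntervalPartition.leftSum, Finset.mul_sum]
  exact Finset.sum_congr rfl fun _ _ => by ring

lemma HasRiemannLimit.sum {a b : ℝ} {ι : Type*} (s : Finset ι) {g : ι → ℝ → ℝ} {c : ι → ℝ}
    (h : ∀ i ∈ s, HasRiemannLimit a b (g i) (c i)) :
    HasRiemannLimit a b (fun t => ∑ i ∈ s, g i t) (∑ i ∈ s, c i) := by
  intro χ hχ
  refine (tendsto_finsetSum s fun i hi => h i hi χ hχ).congr fun k => ?_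
  simp only [IntervalPartition.leftSum, Finset.mul_sum]
  exact Finset.sum_comm

/-- The partition of `[a, b]` whose nodes are the points of a finite set. -/
lemma exists_partition_of_finset {a b : ℝ} (S : Finset ℝ) (hS : ∀ t ∈ S, t ∈ Icc a b)
    (ha : a ∈ S) (hb : b ∈ S) :
    ∃ χ : IntervalPartition a b, range χ.pt = S := by
  have hpos : 0 < S.card := Finset.card_pos.2 ⟨a, ha⟩
  obtain ⟨m, hm⟩ : ∃ m, S.card = m + 1 := ⟨S.card - 1, by omega⟩
  refine ⟨⟨m, S.orderEmbOfFin hm, (S.orderEmbOfFin hm).strictMono, ?_, ?_⟩,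
    S.range_orderEmbOfFin hm⟩
  · have h0 : (0 : Fin (m + 1)) = ⟨0, by omega⟩ := rfl
    rw [h0, Finset.orderEmbOfFin_zero hm (by omega)]
    exact le_antisymm (Finset.min'_le _ _ ha) (hS _ (Finset.min'_mem _ _)).1
  · have h0 : Fin.last m = ⟨m + 1 - 1, by omega⟩ := rfl
    rw [h0, Finset.orderEmbOfFin_last hm (by omega)]
    exact le_antisymm (hS _ (Finset.max'_mem _ _)).2 (Finset.le_max' _ _ hb)

lemma exists_partition_through {x : ℝ} (hx : x ∈ Icc (0 : ℝ) 1) {N : ℕ} (hN : 0 < N) :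
    ∃ χ : IntervalPartition 0 1, χ.mesh ≤ 1 / N ∧ x ∈ range χ.pt := by
  have hN' : (0 : ℝ) < N := Nat.cast_pos.2 hN
  let S : Finset ℝ := insert x ((Finset.range (N + 1)).image fun i : ℕ => (i : ℝ) / N)
  have hmem : ∀ i : ℕ, i ≤ N → (i : ℝ) / N ∈ S := fun i hi =>
    Finset.mem_insert_of_mem (Finset.mem_image.2 ⟨i, by simp; omega, rfl⟩)
  have hS : ∀ t ∈ S, t ∈ Icc (0 : ℝ) 1 := by
    intro t ht
    rcases Finset.mem_insert.1 ht with rfl | ht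
    · exact hx
    · obtain ⟨i, hi, rfl⟩ := Finset.mem_image.1 ht
      have : (i : ℝ) ≤ N := by
        have := Finset.mem_range.1 hi
        exact_mod_cast Nat.lt_succ_iff.1 this
      exact ⟨by positivity, (div_le_one hN').2 this⟩
  obtain ⟨χ, hχ⟩ := exists_partition_of_finset (a := 0) (b := 1) S hS
    (by simpa using hmem 0 (Nat.zero_le _))
    (by simpa [hN'.ne'] using hmem N le_rfl)
  refine ⟨χ, ?_, by rw [hχ]; simp [S]⟩
  refine Real.iSup_le (fun i => ?_) (by positivity)
  set s := χ.pt i.castSucc with hs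
  have hs0 : 0 ≤ s := (χ.pt_mem _).1
  have hs1 : s < 1 := (χ.strictMono_pt i.castSucc_lt_succ).trans_le (χ.pt_mem _).2
  -- The first grid point strictly to the right of `s` is at distance at most 1/N and is itself a
  -- node, so the node following `s` cannot lie beyond it.
  have hfl : ⌊s * N⌋₊ < N := (Nat.floor_lt (by positivity)).2 (by nlinarith)
  have h1 : ((⌊s * N⌋₊ + 1 : ℕ) : ℝ) / N ∈ range χ.pt := by
    rw [hχ]; exact hmem _ hfl
  obtain ⟨j, hj⟩ := h1
  have h2 : s < χ.pt j := by
    rw [hj, lt_div_iff₀ hN']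
    exact_mod_cast Nat.lt_floor_add_one (s * N)
  have h3 : i.succ ≤ j := by
    have := χ.strictMono_pt.lt_iff_lt.1 h2
    exact Fin.castSucc_lt_iff_succ_le.1 this
  have h4 := χ.strictMono_pt.monotone h3
  have h5 : χ.pt j ≤ s + 1 / N := by
    rw [hj, div_le_iff₀ hN', add_mul, one_div, inv_mul_cancel₀ hN'.ne']
    push_cast
    linarith [Nat.floor_le (show 0 ≤ s * N by positivity)]
  linarith

/-! ### The variation function -/

section Variation

variable {X : Type*} [PseudoMetricSpace X] {a b : ℝ} {f : ℝ → X}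

lemma variationFun_eq_variationOnFromTo {t : ℝ} (ht : t ∈ Icc a b) :
    variationFun a f t = variationOnFromTo f (Icc a b) a t := by
  rw [variationOnFromTo.eq_of_le _ _ ht.1, inter_eq_right.2 (Icc_subset_Icc_right ht.2),
    variationFun]

lemma monotoneOn_variationFun (hf : BoundedVariationOn f (Icc a b)) :
    MonotoneOn (variationFun a f) (Icc a b) := by
  intro s hs t ht hst
  rw [variationFun_eq_variationOnFromTo hs, variationFun_eq_variationOnFromTo ht]
  exact variationOnFromTo.monotoneOn hf.locallyBoundedVariationOn
    (left_mem_Icc.2 (hs.1.trans hs.2)) hs ht hst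

lemma dist_le_variationFun_sub (hf : BoundedVariationOn f (Icc a b)) {s t : ℝ}
    (hs : s ∈ Icc a b) (ht : t ∈ Icc a b) (hst : s ≤ t) :
    dist (f s) (f t) ≤ variationFun a f t - variationFun a f s := by
  rw [variationFun_eq_variationOnFromTo hs, variationFun_eq_variationOnFromTo ht,
    variationOnFromTo.sub_right hf.locallyBoundedVariationOn
      (left_mem_Icc.2 (hs.1.trans hs.2)) ht hs, variationOnFromTo.eq_of_le _ _ hst]
  exact (hf.mono inter_subset_left).dist_le ⟨hs, left_mem_Icc.2 hst⟩ ⟨ht, right_mem_Icc.2 hst⟩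

lemma continuousWithinAt_variationFun (hf : BoundedVariationOn f (Icc a b)) {x : ℝ}
    (hx : x ∈ Icc a b) (hc : ContinuousWithinAt f (Icc a b) x) :
    ContinuousWithinAt (variationFun a f) (Icc a b) x := by
  have ha : a ∈ Icc a b := left_mem_Icc.2 (hx.1.trans hx.2)
  have hl := hf.locallyBoundedVariationOn
  -- The one-sided jumps of the variation function equal those of `f`, which vanish here.
  have hL := variationOnFromTo.tendsto_left ha hx hl (hc.mono inter_subset_left)
  have hR := variationOnFromTo.tendsto_right ha hx hl (hc.mono inter_subset_left)
  rw [dist_self, sub_zero] at hL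
  rw [dist_self, add_zero] at hR
  have hcont : ContinuousWithinAt (variationOnFromTo f (Icc a b) a) (Icc a b) x := by
    have hsub : Icc a b ⊆ insert x ((Icc a b ∩ Iio x) ∪ (Icc a b ∩ Ioi x)) := by
      intro t ht
      rcases lt_trichotomy t x with h | h | h
      · exact Or.inr (Or.inl ⟨ht, h⟩)
      · exact Or.inl h
      · exact Or.inr (Or.inr ⟨ht, h⟩)
    refine ContinuousWithinAt.mono ?_ hsub
    rw [continuousWithinAt_insert_self]
    exact ContinuousWithinAt.union hL hR
  exact hcont.congr (fun t ht => variationFun_eq_variationOnFromTo ht)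
    (variationFun_eq_variationOnFromTo hx)

lemma abs_sub_le_localModulus {v : ℝ → ℝ} (hv : MonotoneOn v (Icc a b)) {x δ s t : ℝ}
    (hs : s ∈ Icc a b) (ht : t ∈ Icc a b) (hsx : |s - x| ≤ δ / 2) (htx : |t - x| ≤ δ / 2) :
    |v s - v t| ≤ localModulus a b v x δ := by
  have hab : a ≤ b := hs.1.trans hs.2
  rw [abs_le] at hsx htx
  -- Monotonicity serves only to bound the set, so that `sSup` is a genuine supremum.
  refine le_csSup ⟨v b - v a, ?_⟩ ⟨s, ⟨⟨by linarith, by linarith⟩, hs⟩, t,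
    ⟨⟨by linarith, by linarith⟩, ht⟩, rfl⟩
  rintro r ⟨x₁, ⟨-, h₁⟩, x₂, ⟨-, h₂⟩, rfl⟩
  have e1 := hv (left_mem_Icc.2 hab) h₁ h₁.1
  have e2 := hv h₁ (right_mem_Icc.2 hab) h₁.2
  have e3 := hv (left_mem_Icc.2 hab) h₂ h₂.1
  have e4 := hv h₂ (right_mem_Icc.2 hab) h₂.2
  rw [Real.dist_eq, abs_le]
  constructor <;> linarith

/-- The local modulus of continuity tends to zero uniformly on a compact set of points of
continuity. -/
lemma exists_localModulus_le {v : ℝ → ℝ} (hab : a ≤ b) {K : Set ℝ} (hK : IsCompact K)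
    (hKs : K ⊆ Icc a b) (hv : ∀ x ∈ K, ContinuousWithinAt v (Icc a b) x) {ε : ℝ} (hε : 0 < ε) :
    ∃ δ > 0, ∀ x ∈ K, localModulus a b v x δ ≤ ε := by
  -- Extending `v` by constants outside [a, b] turns continuity within the interval into continuity
  -- at each point of `K`.
  let w : ℝ → ℝ := fun t => v (projIcc a b hab t)
  have hw : ∀ x ∈ K, ContinuousAt w x := by
    intro x hx
    have hp : ((projIcc a b hab x : Icc a b) : ℝ) = x := by rw [projIcc_of_mem hab (hKs hx)]
    have h1 : ContinuousWithinAt v (Icc a b) ((projIcc a b hab x : Icc a b) : ℝ) := by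
      rw [hp]; exact hv x hx
    have h2 : Tendsto (fun t => ((projIcc a b hab t : Icc a b) : ℝ)) (𝓝 x)
        (𝓝[Icc a b] ((projIcc a b hab x : Icc a b) : ℝ)) :=
      tendsto_nhdsWithin_iff.2
        ⟨(continuous_subtype_val.comp continuous_projIcc).continuousAt,
          Eventually.of_forall fun t => (projIcc a b hab t).2⟩
    exact Tendsto.comp h1 h2
  have hU := hK.uniformContinuousAt_of_continuousAt w hw (Metric.dist_mem_uniformity (half_pos hε))
  obtain ⟨η, hη, hη'⟩ := Metric.mem_uniformity_dist.1 hU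
  refine ⟨η, hη, fun x hx => ?_⟩
  have key : ∀ s ∈ Icc (x - η / 2) (x + η / 2) ∩ Icc a b, dist (v x) (v s) < ε / 2 := by
    rintro s ⟨hs, hs'⟩
    have h1 : dist x s < η := by
      rw [Real.dist_eq, abs_lt]
      constructor <;> linarith [hs.1, hs.2]
    have h2 := hη' h1 hx
    simpa [w, projIcc_of_mem hab (hKs hx), projIcc_of_mem hab hs'] using h2
  refine Real.sSup_le ?_ hε.le
  rintro r ⟨s, hs, t, ht, rfl⟩
  linarith [dist_triangle_left (v s) (v t) (v x), key s hs, key t ht]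

end Variation

/-! ### Metric chains -/

section Chains

variable {E : Type*} [NormedAddCommGroup E]

lemma dist_le_of_mem_metricPairs {A B : NonemptyCompacts E} {p : E × E}
    (hp : p ∈ metricPairs (A : Set E) (B : Set E)) : dist p.1 p.2 ≤ dist A B := by
  obtain ⟨h1, h2, h⟩ := hp
  have hfin : Metric.hausdorffEDist (A : Set E) (B : Set E) ≠ ⊤ :=
    Metric.hausdorffEDist_ne_top_of_nonempty_of_bounded A.nonempty B.nonempty
      A.isCompact.isBounded B.isCompact.isBounded
  rw [Metric.NonemptyCompacts.dist_eq]
  rcases h with h | h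
  · rw [dist_comm, h, Metric.hausdorffDist_comm]
    rw [Metric.hausdorffEDist_comm] at hfin
    exact Metric.infDist_le_hausdorffDist_of_mem h2 hfin
  · rw [h]
    exact Metric.infDist_le_hausdorffDist_of_mem h1 hfin

lemma exists_forward_chain (A : ℕ → NonemptyCompacts E) {y : E} (hy : y ∈ A 0) :
    ∃ f : ℕ → E, f 0 = y ∧ ∀ k, f k ∈ A k ∧
      dist (f k) (f (k + 1)) = Metric.infDist (f k) (A (k + 1)) := by
  choose P hP hP' using fun (B : NonemptyCompacts E) (e : E) =>
    B.isCompact.exists_infDist_eq_dist B.nonempty e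
  let f : ℕ → E := fun k => Nat.rec y (fun k e => P (A (k + 1)) e) k
  refine ⟨f, rfl, fun k => ⟨?_, (hP' (A (k + 1)) (f k)).symm⟩⟩
  cases k with
  | zero => exact hy
  | succ k => exact hP (A (k + 1)) (f k)

/-- Through every point of a member of a sequence of compact sets there is a metric chain. -/
lemma exists_chain_through (A : ℕ → NonemptyCompacts E) (j : ℕ) {y : E} (hy : y ∈ A j) :
    ∃ f : ℕ → E, f j = y ∧ (∀ i, f i ∈ A i) ∧
      ∀ i, (f i, f (i + 1)) ∈ metricPairs (A i : Set E) (A (i + 1) : Set E) := by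
  obtain ⟨g, hg0, hg⟩ := exists_forward_chain (fun k => A (j + k)) (by simpa using hy)
  -- Successive projections from index `j` go up with `g` and down with `h`; these supply the two
  -- alternatives in the definition of a metric pair. Truncated subtraction makes the reversed
  -- sequence constant beyond `j`, where it is not used.
  obtain ⟨h, hh0, hh⟩ := exists_forward_chain (fun k => A (j - k)) (by simpa using hy)
  let f : ℕ → E := fun i => if j ≤ i then g (i - j) else h (j - i)
  have hmem : ∀ i, f i ∈ A i := by
    intro i
    by_cases hi : j ≤ i
    · have := (hg (i - j)).1
      simpa [f, hi] using this
    · have := (hh (j - i)).1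
      rw [Nat.sub_sub_self (by omega)] at this
      simpa [f, hi] using this
  refine ⟨f, by simp [f, hg0], hmem, fun i => ⟨hmem i, hmem (i + 1), ?_⟩⟩
  by_cases hi : j ≤ i
  · right
    have := (hg (i - j)).2
    have e1 : j + (i - j + 1) = i + 1 := by omega
    have e2 : i - j + 1 = i + 1 - j := by omega
    rw [e1, e2] at this
    simpa [f, hi, Nat.le_succ_of_le hi] using this
  · left
    have := (hh (j - (i + 1))).2
    have e1 : j - (j - (i + 1) + 1) = i := by omega
    have e2 : j - (i + 1) + 1 = j - i := by omega
    rw [e1, e2] at this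
    have e3 : f (i + 1) = h (j - (i + 1)) := by
      by_cases hi' : j ≤ i + 1
      · have : i + 1 = j := by omega
        simp [f, this, hg0, hh0]
      · simp [f, hi']
    rw [e3]
    simpa [f, hi] using this

lemma dist_le_abs_sub_of_forall_succ {m : ℕ} {y : Fin m → E} {w : Fin m → ℝ}
    (h : ∀ i j : Fin m, (i : ℕ) + 1 = j → dist (y i) (y j) ≤ w j - w i) (i j : Fin m) :
    dist (y i) (y j) ≤ |w i - w j| := by
  wlog hij : i ≤ j generalizing i j
  · rw [dist_comm, abs_sub_comm]
    exact this j i (le_of_not_ge hij)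
  have key : ∀ d : ℕ, ∀ j : Fin m, (i : ℕ) + d = j → dist (y i) (y j) ≤ w j - w i := by
    intro d
    induction d with
    | zero =>
      intro j hj
      obtain rfl : i = j := Fin.ext (by simpa using hj)
      simp
    | succ d ih =>
      intro j hj
      have h1 := ih ⟨i + d, by omega⟩ rfl
      have h2 := h ⟨i + d, by omega⟩ j (by simp; omega)
      linarith [dist_triangle (y i) (y ⟨i + d, by omega⟩) (y j)]
  rw [abs_sub_comm]
  exact (key (j - i) j (by have := Fin.le_def.1 hij; omega)).trans (le_abs_self _)

/-- The Hausdorff distance between neighbouring values is at most the increment of v_F; telescoping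
transfers this control to all pairs of chain entries. -/
lemma dist_le_of_mem_metricChains {a b : ℝ} {F : ℝ → NonemptyCompacts E}
    (hF : BoundedVariationOn F (Icc a b)) {m : ℕ} {t : Fin m → ℝ} (ht : Monotone t)
    (htm : ∀ i, t i ∈ Icc a b) {y : Fin m → E}
    (hy : y ∈ metricChains (fun i => (F (t i) : Set E))) (i j : Fin m) :
    dist (y i) (y j) ≤ |variationFun a F (t i) - variationFun a F (t j)| := by
  refine dist_le_abs_sub_of_forall_succ (w := fun i => variationFun a F (t i)) ?_ i j
  intro i j hij
  refine (dist_le_of_mem_metricPairs (hy.2 i j hij)).trans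
    (dist_le_variationFun_sub hF (htm i) (htm j) (ht ?_))
  rw [Fin.le_def]; omega

/-- Through every point of the value of `F` at a node of a partition there is a metric chain, here
estimated at the left end points of the subintervals. -/
lemma exists_metricChain_dist_le {a b : ℝ} {F : ℝ → NonemptyCompacts E}
    (hF : BoundedVariationOn F (Icc a b)) (χ : IntervalPartition a b) {x : ℝ}
    (hx : x ∈ range χ.pt) {y : E} (hy : y ∈ F x) :
    ∃ η ∈ metricChains (fun i : Fin χ.m => (F (χ.pt i.castSucc) : Set E)),
      ∀ i, dist (η i) y ≤ |variationFun a F (χ.pt i.castSucc) - variationFun a F x| := by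
  obtain ⟨j, rfl⟩ := hx
  let A : ℕ → NonemptyCompacts E := fun k => F (χ.pt ⟨min k χ.m, by omega⟩)
  have hA : ∀ i : Fin (χ.m + 1), A i = F (χ.pt i) := by
    intro i
    have : (⟨min (i : ℕ) χ.m, by omega⟩ : Fin (χ.m + 1)) = i := Fin.ext (by simp; omega)
    simp only [A, this]
  obtain ⟨f, hfj, hfm, hfp⟩ := exists_chain_through A j (y := y) (by rw [hA]; exact hy)
  have hc : (fun i : Fin (χ.m + 1) => f i) ∈
      metricChains (fun i : Fin (χ.m + 1) => (F (χ.pt i) : Set E)) := by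
    refine ⟨fun i => ?_, fun i k hik => ?_⟩
    · have := hfm i
      rw [hA] at this
      exact this
    · have := hfp i
      rw [hik, hA, hA] at this
      exact this
  -- The chain was built over all m + 1 nodes, so that `x` may be the right end point; dropping its
  -- last entry leaves a chain over the left end points.
  refine ⟨fun i => f (i.castSucc : Fin (χ.m + 1)),
    ⟨fun i => hc.1 i.castSucc, fun i k hik => hc.2 i.castSucc k.castSucc (by simpa using hik)⟩,
    fun i => ?_⟩
  have := dist_le_of_mem_metricChains hF χ.strictMono_pt.monotone χ.pt_mem hc i.castSucc j
  simpa only [hfj] using this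

lemma norm_le_supNorm {a b : ℝ} {F : ℝ → NonemptyCompacts E} (hF : IsBVCompactGraph a b F)
    {t : ℝ} (ht : t ∈ Icc a b) {y : E} (hy : y ∈ F t) : ‖y‖ ≤ supNorm a b F := by
  have hle : ∀ (A : NonemptyCompacts E), ∀ y ∈ A, ‖y‖ ≤ Metric.hausdorffDist (A : Set E) {0} := by
    intro A y hy
    have := Metric.infDist_le_hausdorffDist_of_mem (s := (A : Set E)) (t := {0}) hy
      (Metric.hausdorffEDist_ne_top_of_nonempty_of_bounded A.nonempty (singleton_nonempty _)
      A.isCompact.isBounded Bornology.isBounded_singleton)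
    simpa using this
  obtain ⟨R, hR⟩ := (hF.isCompact_graph.image continuous_snd).isBounded.exists_norm_le
  -- Compactness of the graph bounds all values of `F` at once; without this the real `⨆` could take
  -- its default value 0.
  have hb : BddAbove (range fun x : Icc a b => Metric.hausdorffDist (F x : Set E) {0}) := by
    refine ⟨max R 0, ?_⟩
    rintro _ ⟨s, rfl⟩
    have hs : ∀ z ∈ (F s : Set E), ‖z‖ ≤ R := fun z hz => hR z ⟨(s, z), ⟨s.2, hz⟩, rfl⟩
    refine Metric.hausdorffDist_le_of_mem_dist (le_max_right _ _)
      (fun z hz => ⟨0, rfl, by simpa using Or.inl (hs z hz)⟩) ?_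
    rintro _ rfl
    obtain ⟨z, hz⟩ := (F s).nonempty
    exact ⟨z, hz, by simpa using Or.inl (hs z hz)⟩
  exact (hle _ y hy).trans (le_ciSup hb ⟨t, ht⟩)

lemma supNorm_nonneg (a b : ℝ) (F : ℝ → NonemptyCompacts E) : 0 ≤ supNorm a b F :=
  Real.iSup_nonneg fun _ => Metric.hausdorffDist_nonneg

end Chains

/-! ### Weighted metric integrals with a nonnegative weight of unit mass -/

section Integral

variable {E : Type*} [NormedAddCommGroup E] [NormedSpace ℝ E] {a b : ℝ} {κ : ℝ → ℝ}
  {F : ℝ → NonemptyCompacts E}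

/-- Chebyshev's argument for sums. The last term appears because the discrete mass of the kernel is
1 only in the limit. -/
lemma norm_riemannSum_sub_le (χ : IntervalPartition a b) (hκ : ∀ t ∈ Icc a b, 0 ≤ κ t)
    {y : Fin χ.m → E} {e : E} {x δ W B : ℝ} (hδ : 0 < δ) (hW : 0 ≤ W) (he : ‖e‖ ≤ B)
    (hyB : ∀ i, ‖y i‖ ≤ B) (hyW : ∀ i, |χ.pt i.castSucc - x| ≤ δ → ‖y i - e‖ ≤ W) :
    ‖(∑ i : Fin χ.m, ((χ.pt i.succ - χ.pt i.castSucc) * κ (χ.pt i.castSucc)) • y i) - e‖ ≤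
      W * χ.leftSum κ + 2 * B / δ ^ 2 * χ.leftSum (fun t => κ t * (t - x) ^ 2) +
        |χ.leftSum κ - 1| * B := by
  have hB : 0 ≤ B := (norm_nonneg e).trans he
  have hsplit : (∑ i : Fin χ.m,
      ((χ.pt i.succ - χ.pt i.castSucc) * κ (χ.pt i.castSucc)) • y i) - e =
      (∑ i : Fin χ.m, ((χ.pt i.succ - χ.pt i.castSucc) * κ (χ.pt i.castSucc)) • (y i - e)) +
        (χ.leftSum κ - 1) • e := by
    simp only [smul_sub, Finset.sum_sub_distrib, sub_smul, one_smul, IntervalPartition.leftSum,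
      Finset.sum_smul]
    abel
  have hpt : ∀ i, ‖y i - e‖ ≤ W + 2 * B / δ ^ 2 * (χ.pt i.castSucc - x) ^ 2 := by
    intro i
    by_cases hi : |χ.pt i.castSucc - x| ≤ δ
    · exact (hyW i hi).trans (le_add_of_nonneg_right (by positivity))
    · have h1 : δ ^ 2 ≤ (χ.pt i.castSucc - x) ^ 2 := by
        rw [← sq_abs (χ.pt i.castSucc - x)]
        exact pow_le_pow_left₀ hδ.le (not_le.1 hi).le 2
      have h2 : 2 * B ≤ 2 * B / δ ^ 2 * (χ.pt i.castSucc - x) ^ 2 := by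
        rw [div_mul_eq_mul_div, le_div_iff₀ (by positivity)]
        exact mul_le_mul_of_nonneg_left h1 (by positivity)
      linarith [norm_sub_le (y i) e, hyB i]
  rw [hsplit]
  refine (norm_add_le _ _).trans (add_le_add ?_ ?_)
  · refine (norm_sum_le _ _).trans ?_
    simp only [IntervalPartition.leftSum, Finset.mul_sum, ← Finset.sum_add_distrib]
    refine Finset.sum_le_sum fun i _ => ?_
    have h0 : 0 ≤ (χ.pt i.succ - χ.pt i.castSucc) * κ (χ.pt i.castSucc) :=
      mul_nonneg (χ.step_nonneg i) (hκ _ (χ.pt_mem _))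
    rw [norm_smul, Real.norm_of_nonneg h0]
    refine (mul_le_mul_of_nonneg_left (hpt i) h0).trans_eq ?_
    ring
  · rw [norm_smul, Real.norm_eq_abs]
    exact mul_le_mul_of_nonneg_left he (abs_nonneg _)

lemma norm_le_of_mem_metricRiemannSum (hF : IsBVCompactGraph a b F)
    (hκ : ∀ t ∈ Icc a b, 0 ≤ κ t) {χ : IntervalPartition a b} {z : E}
    (hz : z ∈ metricRiemannSum κ F χ) : ‖z‖ ≤ χ.leftSum κ * supNorm a b F := by
  obtain ⟨y, hy, rfl⟩ := hz
  refine (norm_sum_le _ _).trans ?_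
  rw [IntervalPartition.leftSum, Finset.sum_mul]
  refine Finset.sum_le_sum fun i _ => ?_
  have h0 : 0 ≤ (χ.pt i.succ - χ.pt i.castSucc) * κ (χ.pt i.castSucc) :=
    mul_nonneg (χ.step_nonneg i) (hκ _ (χ.pt_mem _))
  rw [norm_smul, Real.norm_of_nonneg h0]
  exact mul_le_mul_of_nonneg_left (norm_le_supNorm hF (χ.pt_mem _) (hy.1 i)) h0

/-- A diagonal choice: the k-th point is approximated within 1/(k+1) by a Riemann sum of mesh below
1/(k+1). -/
lemma isClosed_weightedMetricIntegral : IsClosed (weightedMetricIntegral a b κ F) := by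
  refine IsSeqClosed.isClosed fun z z₀ hz hz₀ => ?_
  have key : ∀ k : ℕ, ∃ (χ : IntervalPartition a b) (y : E), χ.mesh < 1 / ((k : ℝ) + 1) ∧
      y ∈ metricRiemannSum κ F χ ∧ dist y (z k) < 1 / ((k : ℝ) + 1) := by
    intro k
    obtain ⟨χ, y, hχ, hy, hyz⟩ := hz k
    have hk : (0 : ℝ) < 1 / ((k : ℝ) + 1) := Nat.one_div_pos_of_nat
    obtain ⟨i, h1, h2⟩ :=
      ((hχ.eventually_lt_const hk).and (Metric.tendsto_nhds.1 hyz _ hk)).exists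
    exact ⟨χ i, y i, h1, hy i, h2⟩
  choose χ y hχ hy hyz using key
  refine ⟨χ, y, squeeze_zero (fun k => (χ k).mesh_nonneg) (fun k => (hχ k).le)
    tendsto_one_div_add_atTop_nhds_zero_nat, hy, ?_⟩
  refine hz₀.congr_dist ?_
  refine squeeze_zero (fun _ => dist_nonneg) (fun k => ?_)
    tendsto_one_div_add_atTop_nhds_zero_nat
  rw [dist_comm]
  exact (hyz k).le

lemma isCompact_weightedMetricIntegral [FiniteDimensional ℝ E] (hF : IsBVCompactGraph a b F)
    (hκ : ∀ t ∈ Icc a b, 0 ≤ κ t) {c : ℝ} (h0 : HasRiemannLimit a b κ c) :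
    IsCompact (weightedMetricIntegral a b κ F) := by
  have : ProperSpace E := FiniteDimensional.proper_real E
  refine (isCompact_closedBall (0 : E) (c * supNorm a b F)).of_isClosed_subset
    isClosed_weightedMetricIntegral ?_
  rintro z ⟨χ, y, hχ, hy, hyz⟩
  rw [mem_closedBall_zero_iff]
  exact le_of_tendsto_of_tendsto' hyz.norm ((h0 χ hχ).mul_const _)
    fun k => norm_le_of_mem_metricRiemannSum hF hκ (hy k)

variable {x δ C : ℝ}

lemma tendsto_error (h0 : HasRiemannLimit a b κ 1)
    (h2 : HasRiemannLimit a b (fun t => κ t * (t - x) ^ 2) C) {χ : ℕ → IntervalPartition a b}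
    (hχ : Tendsto (fun k => (χ k).mesh) atTop (𝓝 0)) (W B : ℝ) :
    Tendsto (fun k => W * (χ k).leftSum κ +
      2 * B / δ ^ 2 * (χ k).leftSum (fun t => κ t * (t - x) ^ 2) + |(χ k).leftSum κ - 1| * B)
      atTop (𝓝 (W + 2 * B / δ ^ 2 * C)) := by
  have h := (((h0 χ hχ).const_mul W).add ((h2 χ hχ).const_mul (2 * B / δ ^ 2))).add
    (((h0 χ hχ).sub_const 1).abs.mul_const B)
  simpa using h

lemma exists_mem_value_dist_le (hab : a < b) (hF : IsBVCompactGraph a b F)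
    (hκ : ∀ t ∈ Icc a b, 0 ≤ κ t) (hx : x ∈ Icc a b) (hδ : 0 < δ)
    (h0 : HasRiemannLimit a b κ 1)
    (h2 : HasRiemannLimit a b (fun t => κ t * (t - x) ^ 2) C)
    {z : E} (hz : z ∈ weightedMetricIntegral a b κ F) :
    ∃ e ∈ F x, dist z e ≤
      localModulus a b (variationFun a F) x (4 * δ) + 2 * supNorm a b F / δ ^ 2 * C := by
  obtain ⟨χ, u, hχ, hu, huz⟩ := hz
  choose i hi using fun k => (χ k).exists_pt_castSucc_le hab hx
  choose y hy hyu using hu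
  obtain ⟨⟨t, e⟩, ⟨ht, he⟩, φ, hφ, hlim⟩ := hF.isCompact_graph.tendsto_subseq
    (x := fun k => ((χ k).pt (i k).castSucc, y k (i k)))
    fun k => ⟨(χ k).pt_mem _, (hy k).1 _⟩
  rw [Prod.tendsto_iff] at hlim
  have hnode : Tendsto (fun k => (χ k).pt (i k).castSucc) atTop (𝓝 x) := by
    rw [tendsto_iff_dist_tendsto_zero]
    exact squeeze_zero (fun _ => dist_nonneg) hi hχ
  obtain rfl : x = t := tendsto_nhds_unique (hnode.comp hφ.tendsto_atTop) hlim.1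
  refine ⟨e, he, ?_⟩
  have hmono := monotoneOn_variationFun hF.boundedVariation
  have hev : ∀ᶠ k in atTop, dist (u k) (y k (i k)) ≤
      localModulus a b (variationFun a F) x (4 * δ) * (χ k).leftSum κ +
      2 * supNorm a b F / δ ^ 2 * (χ k).leftSum (fun t => κ t * (t - x) ^ 2) +
      |(χ k).leftSum κ - 1| * supNorm a b F := by
    filter_upwards [hχ.eventually_lt_const hδ] with k hk
    rw [hyu k, dist_eq_norm]
    refine norm_riemannSum_sub_le (χ k) hκ hδ (Real.sSup_nonneg ?_)
      (norm_le_supNorm hF ((χ k).pt_mem _) ((hy k).1 _))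
      (fun l => norm_le_supNorm hF ((χ k).pt_mem _) ((hy k).1 l)) fun l hl => ?_
    · rintro _ ⟨_, _, _, _, rfl⟩
      exact dist_nonneg
    · rw [← dist_eq_norm]
      refine (dist_le_of_mem_metricChains hF.boundedVariation (t := fun l => (χ k).pt l.castSucc)
        ((χ k).strictMono_pt.comp Fin.strictMono_castSucc).monotone
        (fun _ => (χ k).pt_mem _) (hy k) l (i k)).trans ?_
      -- Both nodes are within δ of `x`, one by the case assumption and the other because the mesh
      -- is below δ; the window of half-width 2δ contains them with room to spare.
      exact abs_sub_le_localModulus hmono ((χ k).pt_mem _) ((χ k).pt_mem _)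
        (by linarith) (by linarith [hi k])
  refine le_of_tendsto_of_tendsto ((huz.comp hφ.tendsto_atTop).dist hlim.2)
    ((tendsto_error h0 h2 hχ _ _).comp hφ.tendsto_atTop) ?_
  exact hφ.tendsto_atTop.eventually hev

lemma exists_mem_weightedMetricIntegral_dist_le [FiniteDimensional ℝ E] {κ : ℝ → ℝ}
    (hF : IsBVCompactGraph 0 1 F)
    (hκ : ∀ t ∈ Icc (0 : ℝ) 1, 0 ≤ κ t) (hx : x ∈ Icc (0 : ℝ) 1) (hδ : 0 < δ)
    (h0 : HasRiemannLimit 0 1 κ 1)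
    (h2 : HasRiemannLimit 0 1 (fun t => κ t * (t - x) ^ 2) C)
    {e : E} (he : e ∈ F x) :
    ∃ z ∈ weightedMetricIntegral 0 1 κ F, dist z e ≤
      localModulus 0 1 (variationFun 0 F) x (4 * δ) + 2 * supNorm 0 1 F / δ ^ 2 * C := by
  have : ProperSpace E := FiniteDimensional.proper_real E
  choose χ hχN hχx using fun k : ℕ => exists_partition_through hx k.succ_pos
  have hχ : Tendsto (fun k => (χ k).mesh) atTop (𝓝 0) := by
    refine squeeze_zero (fun k => (χ k).mesh_nonneg) (fun k => ?_)
      tendsto_one_div_add_atTop_nhds_zero_nat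
    exact_mod_cast hχN k
  choose y hy hyd using fun k => exists_metricChain_dist_le hF.boundedVariation (χ k) (hχx k) he
  let u : ℕ → E := fun k => ∑ i : Fin (χ k).m,
    (((χ k).pt i.succ - (χ k).pt i.castSucc) * κ ((χ k).pt i.castSucc)) • y k i
  have hu : ∀ k, u k ∈ metricRiemannSum κ F (χ k) := fun k => ⟨y k, hy k, rfl⟩
  have hmono := monotoneOn_variationFun hF.boundedVariation
  have hud : ∀ k, dist (u k) e ≤
      localModulus 0 1 (variationFun 0 F) x (4 * δ) * (χ k).leftSum κ +
      2 * supNorm 0 1 F / δ ^ 2 * (χ k).leftSum (fun t => κ t * (t - x) ^ 2) +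
      |(χ k).leftSum κ - 1| * supNorm 0 1 F := by
    intro k
    rw [dist_eq_norm]
    refine norm_riemannSum_sub_le (χ k) hκ hδ (Real.sSup_nonneg ?_)
      (norm_le_supNorm hF hx he)
      (fun l => norm_le_supNorm hF ((χ k).pt_mem _) ((hy k).1 l)) fun l hl => ?_
    · rintro _ ⟨_, _, _, _, rfl⟩
      exact dist_nonneg
    · rw [← dist_eq_norm]
      refine (hyd k l).trans ?_
      exact abs_sub_le_localModulus hmono ((χ k).pt_mem _) hx
        (by linarith) (by rw [sub_self, abs_zero]; positivity)
  have hlim := tendsto_error (δ := δ) h0 h2 hχ (localModulus 0 1 (variationFun 0 F) x (4 * δ))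
    (supNorm 0 1 F)
  obtain ⟨R, hR⟩ := hlim.bddAbove_range
  obtain ⟨z, -, φ, hφ, hz⟩ := (isCompact_closedBall e R).tendsto_subseq (x := u)
    fun k => Metric.mem_closedBall.2 ((hud k).trans (hR ⟨k, rfl⟩))
  refine ⟨z, ⟨χ ∘ φ, u ∘ φ, hχ.comp hφ.tendsto_atTop, fun k => hu _, hz⟩, ?_⟩
  exact le_of_tendsto_of_tendsto' (hz.dist tendsto_const_nhds)
    (hlim.comp hφ.tendsto_atTop) fun k => hud (φ k)

lemma weightedMetricIntegral_nonempty [FiniteDimensional ℝ E] {κ : ℝ → ℝ}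
    (hF : IsBVCompactGraph 0 1 F) (hκ : ∀ t ∈ Icc (0 : ℝ) 1, 0 ≤ κ t)
    (hx : x ∈ Icc (0 : ℝ) 1) (h0 : HasRiemannLimit 0 1 κ 1)
    (h2 : HasRiemannLimit 0 1 (fun t => κ t * (t - x) ^ 2) C) :
    (weightedMetricIntegral 0 1 κ F).Nonempty := by
  obtain ⟨e, he⟩ := (F x).nonempty
  obtain ⟨z, hz, -⟩ :=
    exists_mem_weightedMetricIntegral_dist_le hF hκ hx one_pos h0 h2 he
  exact ⟨z, hz⟩

lemma hausdorffDist_weightedMetricIntegral_le [FiniteDimensional ℝ E] {κ : ℝ → ℝ}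
    (hF : IsBVCompactGraph 0 1 F) (hκ : ∀ t ∈ Icc (0 : ℝ) 1, 0 ≤ κ t)
    (hx : x ∈ Icc (0 : ℝ) 1) (hδ : 0 < δ) (h0 : HasRiemannLimit 0 1 κ 1)
    (h2 : HasRiemannLimit 0 1 (fun t => κ t * (t - x) ^ 2) C) :
    Metric.hausdorffDist (weightedMetricIntegral 0 1 κ F) (F x : Set E) ≤
      localModulus 0 1 (variationFun 0 F) x (4 * δ) + 2 * supNorm 0 1 F / δ ^ 2 * C := by
  have h1 : ∀ z ∈ weightedMetricIntegral 0 1 κ F, ∃ e ∈ (F x : Set E), dist z e ≤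
      localModulus 0 1 (variationFun 0 F) x (4 * δ) + 2 * supNorm 0 1 F / δ ^ 2 * C :=
    fun z hz => exists_mem_value_dist_le one_pos hF hκ hx hδ h0 h2 hz
  -- A point of the integral is needed only to see that the bound is nonnegative.
  obtain ⟨z, hz⟩ := weightedMetricIntegral_nonempty hF hκ hx h0 h2
  obtain ⟨e, -, he⟩ := h1 z hz
  refine Metric.hausdorffDist_le_of_mem_dist (dist_nonneg.trans he) h1 fun e he => ?_
  obtain ⟨z, hz, hze⟩ := exists_mem_weightedMetricIntegral_dist_le hF hκ hx hδ h0 h2 he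
  exact ⟨z, hz, by rwa [dist_comm]⟩

end Integral

/-! ### Convergence from the error estimate -/

section Convergence

variable {E : Type*} [NormedAddCommGroup E] {F : ℝ → NonemptyCompacts E}

/-- Choose δ to make the modulus small on all of `K`, then `n` large. A general compact `K` covers
both closed intervals and, as singletons, single points. -/
lemma tendstoUniformlyOn_hausdorffDist_of_le (hF : BoundedVariationOn F (Icc 0 1))
    {T : ℕ → ℝ → Set E} {c : ℝ}
    (hT : ∀ n : ℕ, 1 ≤ n → ∀ x ∈ Icc (0 : ℝ) 1, ∀ δ : ℝ, 0 < δ →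
      Metric.hausdorffDist (T n x) (F x : Set E) ≤
        localModulus 0 1 (variationFun 0 F) x (4 * δ) + c / δ ^ 2 / n)
    {K : Set ℝ} (hK : IsCompact K) (hKs : K ⊆ Icc 0 1)
    (hc : ∀ x ∈ K, ContinuousWithinAt F (Icc 0 1) x) :
    TendstoUniformlyOn (fun n x => Metric.hausdorffDist (T n x) (F x : Set E)) (fun _ => 0)
      atTop K := by
  rw [Metric.tendstoUniformlyOn_iff]
  intro ε hε
  obtain ⟨δ, hδ, hmod⟩ := exists_localModulus_le zero_le_one hK hKs
    (fun x hx => continuousWithinAt_variationFun hF (hKs hx) (hc x hx)) (half_pos hε)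
  have hlim : Tendsto (fun n : ℕ => c / (δ / 4) ^ 2 / n) atTop (𝓝 0) :=
    tendsto_const_div_atTop_nhds_zero_nat _
  filter_upwards [hlim.eventually_lt_const (half_pos hε), eventually_ge_atTop 1] with n hn hn1 x hx
  have h1 := hT n hn1 x (hKs hx) (δ / 4) (by positivity)
  have h2 := hmod x hx
  rw [mul_div_cancel₀ δ (by norm_num : (4 : ℝ) ≠ 0)] at h1
  rw [dist_zero_left, Real.norm_of_nonneg Metric.hausdorffDist_nonneg]
  linarith

lemma tendsto_hausdorffDist_of_le (hF : BoundedVariationOn F (Icc 0 1))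
    {T : ℕ → ℝ → Set E} {c : ℝ}
    (hT : ∀ n : ℕ, 1 ≤ n → ∀ x ∈ Icc (0 : ℝ) 1, ∀ δ : ℝ, 0 < δ →
      Metric.hausdorffDist (T n x) (F x : Set E) ≤
        localModulus 0 1 (variationFun 0 F) x (4 * δ) + c / δ ^ 2 / n)
    {x : ℝ} (hx : x ∈ Icc (0 : ℝ) 1) (hc : ContinuousWithinAt F (Icc 0 1) x) :
    Tendsto (fun n => Metric.hausdorffDist (T n x) (F x : Set E)) atTop (𝓝 0) :=
  (tendstoUniformlyOn_hausdorffDist_of_le hF hT isCompact_singleton (singleton_subset_iff.2 hx)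
    (by rintro _ rfl; exact hc)).tendsto_at rfl

end Convergence

/-! ### Bernstein polynomials -/

lemma bernsteinPolynomial_eval (n k : ℕ) (t : ℝ) :
    (bernsteinPolynomial ℝ n k).eval t = n.choose k * t ^ k * (1 - t) ^ (n - k) := by
  simp [bernsteinPolynomial]

lemma bernsteinPolynomial_eval_nonneg (n k : ℕ) {t : ℝ} (ht : t ∈ Icc (0 : ℝ) 1) :
    0 ≤ (bernsteinPolynomial ℝ n k).eval t := by
  have h0 := ht.1
  have h1 : 0 ≤ 1 - t := sub_nonneg.2 ht.2
  rw [bernsteinPolynomial_eval]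
  positivity

lemma sum_bernsteinPolynomial_eval (n : ℕ) (x : ℝ) :
    ∑ k ∈ Finset.range (n + 1), (bernsteinPolynomial ℝ n k).eval x = 1 := by
  have := congr_arg (Polynomial.eval x) (bernsteinPolynomial.sum ℝ n)
  simpa [Polynomial.eval_finsetSum] using this

lemma sum_bernsteinPolynomial_eval_mul (n : ℕ) (x : ℝ) :
    ∑ k ∈ Finset.range (n + 1), (bernsteinPolynomial ℝ n k).eval x * k = n * x := by
  have := congr_arg (Polynomial.eval x) (bernsteinPolynomial.sum_smul ℝ n)
  simpa [Polynomial.eval_finsetSum, mul_comm] using this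

lemma sum_bernsteinPolynomial_eval_mul_sq (n : ℕ) (x : ℝ) :
    ∑ k ∈ Finset.range (n + 1), (bernsteinPolynomial ℝ n k).eval x * (k : ℝ) ^ 2 =
      n * (n - 1) * x ^ 2 + n * x := by
  have h := congr_arg (Polynomial.eval x) (bernsteinPolynomial.sum_mul_smul ℝ n)
  have h' : ∑ k ∈ Finset.range (n + 1), ((k : ℝ) * (k - 1)) * (bernsteinPolynomial ℝ n k).eval x =
      n * (n - 1) * x ^ 2 := by
    have hc : ∀ k : ℕ, (k : ℝ) * ((k - 1 : ℕ) : ℝ) = k * (k - 1) := by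
      intro k; cases k <;> simp
    simpa [Polynomial.eval_finsetSum, hc] using h
  rw [← h', ← sum_bernsteinPolynomial_eval_mul n x, ← Finset.sum_add_distrib]
  exact Finset.sum_congr rfl fun _ _ => by ring

/-- The Bernstein average of a quadratic function of the index. -/
lemma sum_bernsteinPolynomial_eval_mul_quadratic (n : ℕ) (x p q r : ℝ) :
    ∑ k ∈ Finset.range (n + 1),
      (bernsteinPolynomial ℝ n k).eval x * (p * (k : ℝ) ^ 2 + q * k + r) =
      p * (n * (n - 1) * x ^ 2 + n * x) + q * (n * x) + r := by
  rw [← sum_bernsteinPolynomial_eval_mul_sq, ← sum_bernsteinPolynomial_eval_mul, Finset.mul_sum,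
    Finset.mul_sum]
  conv_rhs => rw [← mul_one r, ← sum_bernsteinPolynomial_eval n x, Finset.mul_sum]
  rw [← Finset.sum_add_distrib, ← Finset.sum_add_distrib]
  exact Finset.sum_congr rfl fun _ _ => by ring

/-- The derivative of p_{n+1,k+1} is (n+1)(p_{n,k} - p_{n,k+1}), and p_{n+1,k+1} vanishes at 0 and 1
when k < n; hence consecutive integrals agree, and the one for k = 0 is explicit. -/
lemma integral_bernsteinPolynomial {n k : ℕ} (hk : k ≤ n) :
    ∫ t in (0 : ℝ)..1, (bernsteinPolynomial ℝ n k).eval t = 1 / ((n : ℝ) + 1) := by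
  induction k with
  | zero =>
    have h : ∀ t : ℝ, (bernsteinPolynomial ℝ n 0).eval t = (1 - t) ^ n := fun t => by
      simp [bernsteinPolynomial_eval]
    simp only [h]
    rw [intervalIntegral.integral_comp_sub_left (fun t : ℝ => t ^ n) 1]
    simp
  | succ k ih =>
    have hint : ∀ p : Polynomial ℝ, IntervalIntegrable (fun t => p.eval t)
      MeasureTheory.volume 0 1 := fun p => p.continuous.intervalIntegrable _ _
    have hd := intervalIntegral.integral_eq_sub_of_hasDerivAt (a := 0) (b := 1)
      (fun t _ => (bernsteinPolynomial ℝ (n + 1) (k + 1)).hasDerivAt t) (hint _)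
    rw [bernsteinPolynomial.derivative_succ, bernsteinPolynomial.eval_at_1,
      bernsteinPolynomial.eval_at_0, if_neg (by omega), if_neg (by omega)] at hd
    simp only [Polynomial.eval_mul, Polynomial.eval_sub, Nat.add_sub_cancel,
      Polynomial.eval_natCast] at hd
    rw [intervalIntegral.integral_const_mul, intervalIntegral.integral_sub (hint _) (hint _),
      sub_zero] at hd
    rcases mul_eq_zero.1 hd with h | h
    · exact absurd h (by positivity)
    · rw [← ih (by omega)]; linarith

/-- Absorbing a factor `t` by raising the degree reduces the moments of p_{n,k} to plain integrals.
-/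
lemma mul_bernsteinPolynomial_eval (n k : ℕ) (t : ℝ) :
    t * (bernsteinPolynomial ℝ n k).eval t =
      ((k : ℝ) + 1) / ((n : ℝ) + 1) * (bernsteinPolynomial ℝ (n + 1) (k + 1)).eval t := by
  have h : ((n : ℝ) + 1) * n.choose k = (n + 1).choose (k + 1) * ((k : ℝ) + 1) := by
    exact_mod_cast Nat.add_one_mul_choose_eq n k
  have hn : (n : ℝ) + 1 ≠ 0 := by positivity
  rw [div_mul_eq_mul_div, eq_div_iff hn, bernsteinPolynomial_eval, bernsteinPolynomial_eval,
    Nat.add_sub_add_right]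
  linear_combination (t ^ (k + 1) * (1 - t) ^ (n - k)) * h

lemma integral_bernsteinPolynomial_mul_sq {n k : ℕ} (hk : k ≤ n) (x : ℝ) :
    ∫ t in (0 : ℝ)..1, (bernsteinPolynomial ℝ n k).eval t * (t - x) ^ 2 =
      ((k : ℝ) + 1) * (k + 2) / ((n + 1) * (n + 2) * (n + 3)) -
        2 * x * ((k + 1) / ((n + 1) * (n + 2))) + x ^ 2 * (1 / (n + 1)) := by
  have hint : ∀ p : Polynomial ℝ, IntervalIntegrable (fun t => p.eval t)
    MeasureTheory.volume 0 1 := fun p => p.continuous.intervalIntegrable _ _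
  have h : ∀ t : ℝ, (bernsteinPolynomial ℝ n k).eval t * (t - x) ^ 2 =
      ((k : ℝ) + 1) / ((n : ℝ) + 1) * (((k : ℝ) + 2) / ((n : ℝ) + 2)) *
        (bernsteinPolynomial ℝ (n + 2) (k + 2)).eval t -
      2 * x * (((k : ℝ) + 1) / ((n : ℝ) + 1)) *
        (bernsteinPolynomial ℝ (n + 1) (k + 1)).eval t +
      x ^ 2 * (bernsteinPolynomial ℝ n k).eval t := by
    intro t
    have h1 := mul_bernsteinPolynomial_eval n k t
    have h2 := mul_bernsteinPolynomial_eval (n + 1) (k + 1) t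
    push_cast at h2
    rw [show (k : ℝ) + 1 + 1 = k + 2 by ring, show (n : ℝ) + 1 + 1 = n + 2 by ring] at h2
    linear_combination (t - 2 * x) * h1 + ((k : ℝ) + 1) / ((n : ℝ) + 1) * h2
  simp only [h]
  rw [intervalIntegral.integral_add (((hint _).const_mul _).sub ((hint _).const_mul _))
      ((hint _).const_mul _),
    intervalIntegral.integral_sub ((hint _).const_mul _) ((hint _).const_mul _)]
  simp only [intervalIntegral.integral_const_mul]
  rw [integral_bernsteinPolynomial hk, integral_bernsteinPolynomial (by omega : k + 1 ≤ n + 1),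
    integral_bernsteinPolynomial (by omega : k + 2 ≤ n + 2)]
  have h1 : (n : ℝ) + 1 ≠ 0 := by positivity
  have h2 : (n : ℝ) + 2 ≠ 0 := by positivity
  have h3 : (n : ℝ) + 3 ≠ 0 := by positivity
  push_cast
  rw [show (n : ℝ) + 1 + 1 = n + 2 by ring, show (n : ℝ) + 2 + 1 = n + 3 by ring]
  field_simp

/-! ### Functions of bounded variation on the unit interval -/

lemma boundedVariationOn_of_monotoneOn {f : ℝ → ℝ} {a b : ℝ} (hf : MonotoneOn f (Icc a b)) :
    BoundedVariationOn f (Icc a b) := by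
  rcases le_or_gt a b with hab | hab
  · have := hf.locallyBoundedVariationOn a b (left_mem_Icc.2 hab) (right_mem_Icc.2 hab)
    rwa [inter_self] at this
  · rw [Icc_eq_empty hab.not_ge]
    exact BoundedVariationOn.of_subsingleton subsingleton_empty

lemma boundedVariationOn_of_antitoneOn {f : ℝ → ℝ} {a b : ℝ} (hf : AntitoneOn f (Icc a b)) :
    BoundedVariationOn f (Icc a b) := by
  have h1 := boundedVariationOn_of_monotoneOn hf.neg
  have h2 := h1.mul (boundedVariationOn_of_monotoneOn (monotoneOn_const (c := (-1 : ℝ))))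
  convert h2 using 1
  ext t
  simp

lemma boundedVariationOn_bernsteinPolynomial (n k : ℕ) :
    BoundedVariationOn (fun t => (bernsteinPolynomial ℝ n k).eval t) (Icc 0 1) := by
  have h1 : BoundedVariationOn (fun t : ℝ => (n.choose k : ℝ) * t ^ k) (Icc 0 1) :=
    boundedVariationOn_of_monotoneOn fun s hs t _ hst =>
      mul_le_mul_of_nonneg_left (pow_le_pow_left₀ hs.1 hst k) (Nat.cast_nonneg _)
  have h2 : BoundedVariationOn (fun t : ℝ => (1 - t) ^ (n - k)) (Icc 0 1) :=
    boundedVariationOn_of_antitoneOn fun s _ t ht hst =>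
      pow_le_pow_left₀ (sub_nonneg.2 ht.2) (by linarith) _
  simp only [bernsteinPolynomial_eval]
  exact h1.mul h2

/-- The indicator is the product of a monotone and an antitone one, those of the two half-lines. -/
lemma boundedVariationOn_indicator_Icc (a b c d : ℝ) :
    BoundedVariationOn ((Icc c d).indicator fun _ => (1 : ℝ)) (Icc a b) := by
  have h1 : BoundedVariationOn ((Ici c).indicator fun _ => (1 : ℝ)) (Icc a b) := by
    refine boundedVariationOn_of_monotoneOn fun s _ t _ hst => ?_
    by_cases hs : c ≤ s
    · simp [indicator, hs, hs.trans hst]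
    · simpa [indicator, hs] using by split_ifs <;> norm_num
  have h2 : BoundedVariationOn ((Iic d).indicator fun _ => (1 : ℝ)) (Icc a b) := by
    refine boundedVariationOn_of_antitoneOn fun s _ t _ hst => ?_
    by_cases ht : t ≤ d
    · simp [indicator, ht, hst.trans ht]
    · simpa [indicator, ht] using by split_ifs <;> norm_num
  convert h1.mul h2 using 1
  ext t
  rw [← Ici_inter_Iic, Pi.mul_apply, ← inter_indicator_mul, mul_one]

lemma boundedVariationOn_sub_sq (a b x : ℝ) :
    BoundedVariationOn (fun t : ℝ => (t - x) ^ 2) (Icc a b) := by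
  have h : BoundedVariationOn (fun t : ℝ => t - x) (Icc a b) :=
    boundedVariationOn_of_monotoneOn fun s _ t _ hst => by simpa using hst
  simpa only [sq] using! h.mul h

/-! ### The Bernstein–Durrmeyer kernel -/

lemma durrmeyerKernel_nonneg (n : ℕ) {x t : ℝ} (hx : x ∈ Icc (0 : ℝ) 1) (ht : t ∈ Icc (0 : ℝ) 1) :
    0 ≤ durrmeyerKernel n x t :=
  mul_nonneg (by positivity) (Finset.sum_nonneg fun k _ =>
    mul_nonneg (bernsteinPolynomial_eval_nonneg n k hx) (bernsteinPolynomial_eval_nonneg n k ht))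

lemma hasRiemannLimit_durrmeyerKernel (n : ℕ) (x : ℝ) :
    HasRiemannLimit 0 1 (durrmeyerKernel n x) 1 := by
  have hn : (n : ℝ) + 1 ≠ 0 := by positivity
  have h := (HasRiemannLimit.sum (Finset.range (n + 1)) fun k _ =>
    (hasRiemannLimit_integral zero_le_one (boundedVariationOn_bernsteinPolynomial n k)).const_mul
      ((bernsteinPolynomial ℝ n k).eval x)).const_mul ((n : ℝ) + 1)
  have hs : ((n : ℝ) + 1) * ∑ k ∈ Finset.range (n + 1), (bernsteinPolynomial ℝ n k).eval x *
      ∫ t in (0 : ℝ)..1, (bernsteinPolynomial ℝ n k).eval t = 1 := by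
    rw [Finset.sum_congr rfl fun k hk => by
      rw [integral_bernsteinPolynomial (Nat.lt_succ_iff.1 (Finset.mem_range.1 hk))],
      ← Finset.sum_mul, sum_bernsteinPolynomial_eval]
    field_simp
  rw [hs] at h
  exact h

/-- The second central moment of the Bernstein–Durrmeyer operator. -/
lemma hasRiemannLimit_durrmeyerKernel_mul_sq (n : ℕ) (x : ℝ) :
    HasRiemannLimit 0 1 (fun t => durrmeyerKernel n x t * (t - x) ^ 2)
      ((2 * (n - 3) * (x * (1 - x)) + 2) / ((n + 2) * (n + 3))) := by
  have h1 : (n : ℝ) + 1 ≠ 0 := by positivity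
  have h2 : (n : ℝ) + 2 ≠ 0 := by positivity
  have h3 : (n : ℝ) + 3 ≠ 0 := by positivity
  have h := (HasRiemannLimit.sum (Finset.range (n + 1)) fun k _ =>
    (hasRiemannLimit_integral zero_le_one ((boundedVariationOn_bernsteinPolynomial n k).mul
      (boundedVariationOn_sub_sq 0 1 x))).const_mul
      ((bernsteinPolynomial ℝ n k).eval x)).const_mul ((n : ℝ) + 1)
  have hs : ((n : ℝ) + 1) * ∑ k ∈ Finset.range (n + 1), (bernsteinPolynomial ℝ n k).eval x *
      ∫ t in (0 : ℝ)..1, (bernsteinPolynomial ℝ n k).eval t * (t - x) ^ 2 =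
      (2 * (n - 3) * (x * (1 - x)) + 2) / ((n + 2) * (n + 3)) := by
    have hq : ∀ k ∈ Finset.range (n + 1), (bernsteinPolynomial ℝ n k).eval x *
        ∫ t in (0 : ℝ)..1, (bernsteinPolynomial ℝ n k).eval t * (t - x) ^ 2 =
        (bernsteinPolynomial ℝ n k).eval x * (1 / ((n + 1) * (n + 2) * (n + 3)) * (k : ℝ) ^ 2 +
          (3 / ((n + 1) * (n + 2) * (n + 3)) - 2 * x / ((n + 1) * (n + 2))) * k +
          (2 / ((n + 1) * (n + 2) * (n + 3)) - 2 * x / ((n + 1) * (n + 2)) +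
            x ^ 2 / (n + 1))) := by
      intro k hk
      rw [integral_bernsteinPolynomial_mul_sq (Nat.lt_succ_iff.1 (Finset.mem_range.1 hk))]
      ring
    rw [Finset.sum_congr rfl hq, sum_bernsteinPolynomial_eval_mul_quadratic]
    field_simp
    ring
  convert h using 1
  · ext t
    simp only [durrmeyerKernel, Pi.mul_apply, mul_assoc, Finset.sum_mul]
  · exact hs.symm

lemma durrmeyer_moment_le {n : ℕ} (hn : 1 ≤ n) {x : ℝ} (hx : x ∈ Icc (0 : ℝ) 1) :
    (2 * (n - 3) * (x * (1 - x)) + 2) / (((n : ℝ) + 2) * (n + 3)) ≤ 1 / (2 * n) := by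
  have hn' : (1 : ℝ) ≤ n := by exact_mod_cast hn
  have h0 : 0 ≤ x * (1 - x) := mul_nonneg hx.1 (sub_nonneg.2 hx.2)
  have h1 : x * (1 - x) ≤ 1 / 4 := by nlinarith [sq_nonneg (x - 1 / 2)]
  have h2 : (n : ℝ) * (x * (1 - x)) ≤ n * (1 / 4) := mul_le_mul_of_nonneg_left h1 (by linarith)
  -- Discarding the term -6x(1-x) avoids a case split on the sign of n - 3; the remainder suffices,
  -- as n² + 4n ≤ (n+2)(n+3).
  have h3 : 2 * ((n : ℝ) - 3) * (x * (1 - x)) + 2 ≤ n / 2 + 2 := by nlinarith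
  rw [div_le_div_iff₀ (by positivity) (by positivity)]
  nlinarith [mul_le_mul_of_nonneg_right h3 (by positivity : (0 : ℝ) ≤ 2 * n)]

/-! ### The Kantorovich kernel -/

lemma kantorovichKernel_nonneg (n : ℕ) {x : ℝ} (hx : x ∈ Icc (0 : ℝ) 1) (t : ℝ) :
    0 ≤ kantorovichKernel n x t :=
  mul_nonneg (by positivity) (Finset.sum_nonneg fun k _ =>
    mul_nonneg (bernsteinPolynomial_eval_nonneg n k hx)
      (indicator_nonneg (fun _ _ => zero_le_one) t))

lemma integral_indicator_Icc_mul {a b c d : ℝ} (hab : a ≤ b) (hcd : c ≤ d) (hac : a ≤ c)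
    (hdb : d ≤ b) (g : ℝ → ℝ) :
    ∫ t in a..b, ((Icc c d).indicator (fun _ => (1 : ℝ)) t) * g t = ∫ t in c..d, g t := by
  rw [intervalIntegral.integral_of_le hab, intervalIntegral.integral_of_le hcd,
    ← MeasureTheory.integral_Icc_eq_integral_Ioc, ← MeasureTheory.integral_Icc_eq_integral_Ioc]
  have h : (fun t => ((Icc c d).indicator (fun _ => (1 : ℝ)) t) * g t) = (Icc c d).indicator g := by
    ext t
    by_cases ht : t ∈ Icc c d <;> simp [ht]
  rw [h, MeasureTheory.setIntegral_indicator measurableSet_Icc,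
    inter_eq_right.2 (Icc_subset_Icc hac hdb)]

lemma integral_indicator_cell_mul {n k : ℕ} (hk : k ≤ n) (g : ℝ → ℝ) :
    ∫ t in (0 : ℝ)..1, (Icc ((k : ℝ) / ((n : ℝ) + 1)) (((k : ℝ) + 1) / ((n : ℝ) + 1))).indicator
      (fun _ => (1 : ℝ)) t * g t =
      ∫ t in ((k : ℝ) / ((n : ℝ) + 1))..(((k : ℝ) + 1) / ((n : ℝ) + 1)), g t := by
  have hk' : (k : ℝ) ≤ n := by exact_mod_cast hk
  exact integral_indicator_Icc_mul zero_le_one (by gcongr; linarith) (by positivity)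
    ((div_le_one (by positivity)).2 (by linarith)) g

/-- Used with g = 1 for the mass and g = (t-x)² for the second moment. Adjacent closed cells share
an end point, which does not affect the integrals. -/
lemma hasRiemannLimit_kantorovichKernel_mul (n : ℕ) (x : ℝ) {g : ℝ → ℝ}
    (hg : BoundedVariationOn g (Icc 0 1)) :
    HasRiemannLimit 0 1 (fun t => kantorovichKernel n x t * g t)
      (((n : ℝ) + 1) * ∑ k ∈ Finset.range (n + 1), (bernsteinPolynomial ℝ n k).eval x *
        ∫ t in ((k : ℝ) / ((n : ℝ) + 1))..(((k : ℝ) + 1) / ((n : ℝ) + 1)), g t) := by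
  have h := (HasRiemannLimit.sum (Finset.range (n + 1)) fun k _ =>
    (hasRiemannLimit_integral zero_le_one ((boundedVariationOn_indicator_Icc 0 1
      ((k : ℝ) / ((n : ℝ) + 1)) (((k : ℝ) + 1) / ((n : ℝ) + 1))).mul hg)).const_mul
      ((bernsteinPolynomial ℝ n k).eval x)).const_mul ((n : ℝ) + 1)
  convert h using 1
  · ext t
    simp only [kantorovichKernel, Pi.mul_apply, mul_assoc, Finset.sum_mul]
  · congr 1
    refine Finset.sum_congr rfl fun k hk => ?_
    rw [← integral_indicator_cell_mul (Nat.lt_succ_iff.1 (Finset.mem_range.1 hk))]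
    rfl

lemma hasRiemannLimit_kantorovichKernel (n : ℕ) (x : ℝ) :
    HasRiemannLimit 0 1 (kantorovichKernel n x) 1 := by
  have hn : (n : ℝ) + 1 ≠ 0 := by positivity
  have h := hasRiemannLimit_kantorovichKernel_mul n x
    (boundedVariationOn_of_monotoneOn (monotoneOn_const (c := (1 : ℝ))))
  have hk : ∀ k : ℕ, ((k : ℝ) + 1) / ((n : ℝ) + 1) - k / (n + 1) = 1 / (n + 1) := fun k => by
    ring
  simp only [mul_one, intervalIntegral.integral_const, smul_eq_mul, hk] at h
  rw [← Finset.sum_mul, sum_bernsteinPolynomial_eval, one_mul, mul_one_div_cancel hn] at h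
  exact h

/-- The second central moment of the Kantorovich operator. -/
lemma hasRiemannLimit_kantorovichKernel_mul_sq (n : ℕ) (x : ℝ) :
    HasRiemannLimit 0 1 (fun t => kantorovichKernel n x t * (t - x) ^ 2)
      (((n - 1) * (x * (1 - x)) + 1 / 3) / ((n : ℝ) + 1) ^ 2) := by
  have hn : (n : ℝ) + 1 ≠ 0 := by positivity
  have h := hasRiemannLimit_kantorovichKernel_mul n x (boundedVariationOn_sub_sq 0 1 x)
  have hq : ∀ k : ℕ, ∫ t in ((k : ℝ) / ((n : ℝ) + 1))..(((k : ℝ) + 1) / ((n : ℝ) + 1)),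
      (t - x) ^ 2 = 1 / ((n : ℝ) + 1) ^ 3 * (k : ℝ) ^ 2 +
        (1 / ((n : ℝ) + 1) ^ 3 - 2 * x / ((n : ℝ) + 1) ^ 2) * k +
        (1 / (3 * ((n : ℝ) + 1) ^ 3) - x / ((n : ℝ) + 1) ^ 2 + x ^ 2 / ((n : ℝ) + 1)) := by
    intro k
    rw [intervalIntegral.integral_comp_sub_right (fun t => t ^ 2) x, integral_pow]
    push_cast
    field_simp
    ring
  simp only [hq] at h
  rw [sum_bernsteinPolynomial_eval_mul_quadratic] at h
  convert h using 1
  field_simp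
  ring

lemma kantorovich_moment_le {n : ℕ} (hn : 1 ≤ n) (x : ℝ) :
    ((n - 1) * (x * (1 - x)) + 1 / 3) / ((n : ℝ) + 1) ^ 2 ≤ 1 / (4 * n) := by
  have hn' : (1 : ℝ) ≤ n := by exact_mod_cast hn
  have h1 : x * (1 - x) ≤ 1 / 4 := by nlinarith [sq_nonneg (x - 1 / 2)]
  have h2 : ((n : ℝ) - 1) * (x * (1 - x)) ≤ (n - 1) * (1 / 4) :=
    mul_le_mul_of_nonneg_left h1 (by linarith)
  rw [div_le_div_iff₀ (by positivity) (by positivity)]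
  nlinarith [mul_le_mul_of_nonneg_right h2 (by positivity : (0 : ℝ) ≤ 4 * n)]

/-! ### The error estimates -/

section Operators

variable {E : Type*} [NormedAddCommGroup E] [NormedSpace ℝ E] [FiniteDimensional ℝ E]
  {F : ℝ → NonemptyCompacts E}

lemma hausdorffDist_durrmeyerOp_le (hF : IsBVCompactGraph 0 1 F) {n : ℕ} (hn : 1 ≤ n) {x : ℝ}
    (hx : x ∈ Icc (0 : ℝ) 1) {δ : ℝ} (hδ : 0 < δ) :
    Metric.hausdorffDist (durrmeyerOp n F x) (F x : Set E) ≤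
      localModulus 0 1 (variationFun 0 F) x (4 * δ) +
        supNorm 0 1 F * (1 / ((n : ℝ) * δ ^ 2)) := by
  have hn' : (0 : ℝ) < n := by exact_mod_cast hn
  refine (hausdorffDist_weightedMetricIntegral_le hF (fun t ht => durrmeyerKernel_nonneg n hx ht)
    hx hδ (hasRiemannLimit_durrmeyerKernel n x)
    (hasRiemannLimit_durrmeyerKernel_mul_sq n x)).trans ?_
  have hB := supNorm_nonneg 0 1 F
  refine add_le_add_right ?_ _
  refine (mul_le_mul_of_nonneg_left (durrmeyer_moment_le hn hx) (by positivity)).trans_eq ?_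
  field_simp

lemma hausdorffDist_kantorovichOp_le (hF : IsBVCompactGraph 0 1 F) {n : ℕ} (hn : 1 ≤ n) {x : ℝ}
    (hx : x ∈ Icc (0 : ℝ) 1) {δ : ℝ} (hδ : 0 < δ) :
    Metric.hausdorffDist (kantorovichOp n F x) (F x : Set E) ≤
      localModulus 0 1 (variationFun 0 F) x (4 * δ) +
        supNorm 0 1 F * (1 / (2 * (n : ℝ) * δ ^ 2)) := by
  have hn' : (0 : ℝ) < n := by exact_mod_cast hn
  refine (hausdorffDist_weightedMetricIntegral_le hF (fun t _ => kantorovichKernel_nonneg n hx t)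
    hx hδ (hasRiemannLimit_kantorovichKernel n x)
    (hasRiemannLimit_kantorovichKernel_mul_sq n x)).trans ?_
  have hB := supNorm_nonneg 0 1 F
  refine add_le_add_right ?_ _
  refine (mul_le_mul_of_nonneg_left (kantorovich_moment_le hn x) (by positivity)).trans_eq ?_
  ring

end Operators

end MetricApprox

/-- Nonemptiness and compactness give the estimates their meaning: `Metric.hausdorffDist` takes the
default value 0 when the extended distance is infinite, as for an empty set against a nonempty one.
-/
theorem mainTheorem9 {E : Type*} [NormedAddCommGroup E] [NormedSpace ℝ E] [FiniteDimensional ℝ E]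
    (F : ℝ → NonemptyCompacts E) (hF : MetricApprox.IsBVCompactGraph 0 1 F) :
    -- the Bernstein–Durrmeyer operators
    ((∀ n : ℕ, 1 ≤ n → ∀ x ∈ Icc (0 : ℝ) 1,
        (MetricApprox.durrmeyerOp n F x).Nonempty ∧ IsCompact (MetricApprox.durrmeyerOp n F x)) ∧
      (∀ n : ℕ, 1 ≤ n → ∀ x ∈ Icc (0 : ℝ) 1, ∀ δ : ℝ, 0 < δ →
        Metric.hausdorffDist (MetricApprox.durrmeyerOp n F x) (F x : Set E) ≤
          MetricApprox.localModulus 0 1 (MetricApprox.variationFun 0 F) x (4 * δ) +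
            MetricApprox.supNorm 0 1 F * (1 / ((n : ℝ) * δ ^ 2))) ∧
      (∀ x ∈ Icc (0 : ℝ) 1, ContinuousWithinAt F (Icc 0 1) x →
        Tendsto (fun n : ℕ =>
          Metric.hausdorffDist (MetricApprox.durrmeyerOp n F x) (F x : Set E)) atTop (𝓝 0)) ∧
      (∀ c d : ℝ, Icc c d ⊆ Icc (0 : ℝ) 1 →
        (∀ x ∈ Icc c d, ContinuousWithinAt F (Icc 0 1) x) →
        TendstoUniformlyOn (fun (n : ℕ) (x : ℝ) =>
          Metric.hausdorffDist (MetricApprox.durrmeyerOp n F x) (F x : Set E))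
          (fun _ => 0) atTop (Icc c d))) ∧
    -- the Kantorovich operators
    ((∀ n : ℕ, 1 ≤ n → ∀ x ∈ Icc (0 : ℝ) 1,
        (MetricApprox.kantorovichOp n F x).Nonempty ∧
          IsCompact (MetricApprox.kantorovichOp n F x)) ∧
      (∀ n : ℕ, 1 ≤ n → ∀ x ∈ Icc (0 : ℝ) 1, ∀ δ : ℝ, 0 < δ →
        Metric.hausdorffDist (MetricApprox.kantorovichOp n F x) (F x : Set E) ≤
          MetricApprox.localModulus 0 1 (MetricApprox.variationFun 0 F) x (4 * δ) +
            MetricApprox.supNorm 0 1 F * (1 / (2 * (n : ℝ) * δ ^ 2))) ∧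
      (∀ x ∈ Icc (0 : ℝ) 1, ContinuousWithinAt F (Icc 0 1) x →
        Tendsto (fun n : ℕ =>
          Metric.hausdorffDist (MetricApprox.kantorovichOp n F x) (F x : Set E)) atTop (𝓝 0)) ∧
      (∀ c d : ℝ, Icc c d ⊆ Icc (0 : ℝ) 1 →
        (∀ x ∈ Icc c d, ContinuousWithinAt F (Icc 0 1) x) →
        TendstoUniformlyOn (fun (n : ℕ) (x : ℝ) =>
          Metric.hausdorffDist (MetricApprox.kantorovichOp n F x) (F x : Set E))
          (fun _ => 0) atTop (Icc c d))) := by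
  have hM : ∀ n : ℕ, 1 ≤ n → ∀ x ∈ Icc (0 : ℝ) 1, ∀ δ : ℝ, 0 < δ →
      Metric.hausdorffDist (MetricApprox.durrmeyerOp n F x) (F x : Set E) ≤
        MetricApprox.localModulus 0 1 (MetricApprox.variationFun 0 F) x (4 * δ) +
          MetricApprox.supNorm 0 1 F / δ ^ 2 / n := by
    intro n hn x hx δ hδ
    refine (MetricApprox.hausdorffDist_durrmeyerOp_le hF hn hx hδ).trans_eq ?_
    rw [mul_one_div, div_div, mul_comm (n : ℝ)]
  have hK : ∀ n : ℕ, 1 ≤ n → ∀ x ∈ Icc (0 : ℝ) 1, ∀ δ : ℝ, 0 < δ →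
      Metric.hausdorffDist (MetricApprox.kantorovichOp n F x) (F x : Set E) ≤
        MetricApprox.localModulus 0 1 (MetricApprox.variationFun 0 F) x (4 * δ) +
          MetricApprox.supNorm 0 1 F / 2 / δ ^ 2 / n := by
    intro n hn x hx δ hδ
    refine (MetricApprox.hausdorffDist_kantorovichOp_le hF hn hx hδ).trans_eq ?_
    rw [mul_one_div, div_div, div_div, mul_right_comm 2 (n : ℝ), mul_assoc]
  refine ⟨⟨fun n _ x hx => ⟨?_, ?_⟩, fun n hn x hx δ hδ => ?_, fun x hx hc => ?_,
    fun c d hcd hc => ?_⟩, fun n _ x hx => ⟨?_, ?_⟩, fun n hn x hx δ hδ => ?_,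
    fun x hx hc => ?_, fun c d hcd hc => ?_⟩
  · exact MetricApprox.weightedMetricIntegral_nonempty hF
      (fun t ht => MetricApprox.durrmeyerKernel_nonneg n hx ht) hx
      (MetricApprox.hasRiemannLimit_durrmeyerKernel n x)
      (MetricApprox.hasRiemannLimit_durrmeyerKernel_mul_sq n x)
  · exact MetricApprox.isCompact_weightedMetricIntegral hF
      (fun t ht => MetricApprox.durrmeyerKernel_nonneg n hx ht)
      (MetricApprox.hasRiemannLimit_durrmeyerKernel n x)
  · exact MetricApprox.hausdorffDist_durrmeyerOp_le hF hn hx hδ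
  · exact MetricApprox.tendsto_hausdorffDist_of_le hF.boundedVariation hM hx hc
  · exact MetricApprox.tendstoUniformlyOn_hausdorffDist_of_le hF.boundedVariation hM
      isCompact_Icc hcd hc
  · exact MetricApprox.weightedMetricIntegral_nonempty hF
      (fun t _ => MetricApprox.kantorovichKernel_nonneg n hx t) hx
      (MetricApprox.hasRiemannLimit_kantorovichKernel n x)
      (MetricApprox.hasRiemannLimit_kantorovichKernel_mul_sq n x)
  · exact MetricApprox.isCompact_weightedMetricIntegral hF
      (fun t _ => MetricApprox.kantorovichKernel_nonneg n hx t)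
      (MetricApprox.hasRiemannLimit_kantorovichKernel n x)
  · exact MetricApprox.hausdorffDist_kantorovichOp_le hF hn hx hδ
  · exact MetricApprox.tendsto_hausdorffDist_of_le hF.boundedVariation hK hx hc
  · exact MetricApprox.tendstoUniformlyOn_hausdorffDist_of_le hF.boundedVariation hK
      isCompact_Icc hcd hc
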